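/- Let $s\ge 1$ be an integer and let $p$ be a real binary form of degree $2s$ in the variables $x,y$. Consider the representations $p(x,y)=\sum_{j=1}^{r}\lambda_j(\alpha_j x+\beta_j y)^{2s}$ with $r\ge 0$, $\alpha_j,\beta_j\in\mathbb{R}$, and real numbers $\lambda_j\ne 0$, in which the linear forms $\alpha_j x+\beta_j y$ are pairwise non-proportional. Such a representation has badge $(a,b)$ if exactly $a$ of the $\lambda_j$ are positive and exactly $b$ are negative. A signature of $p$ is a badge of $p$ that is minimal, among all badges of such representations of $p$, for the componentwise order ($(a,b)\preceq(c,d)$ if $a\le c$ and $b\le d$). Suppose that $p$ has two signatures $(a,b)$ and $(c,d)$ such that $a>c$ and $b<d$. Then $a+d\ge s+3$, $b+c\ge s+1$, $\max\{a+b,c+d\}\ge s+2$, and $a,b,c,d\ge 1$. -/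

import Mathlib

namespace BinaryForms

/-- The real linear form `α₁ x₁ + ⋯ + αₙ xₙ` with coefficient vector `α`. -/
noncomputable def linearForm {n : ℕ} (α : Fin n → ℝ) : MvPolynomial (Fin n) ℝ :=
  ∑ i, MvPolynomial.C (α i) * MvPolynomial.X i

/-- `p = ∑ⱼ lam j • (linear form with coefficients α j) ^ d`, with all `lam j` nonzero. -/
def IsRepresentation {n r : ℕ} (d : ℕ) (p : MvPolynomial (Fin n) ℝ)
    (lam : Fin r → ℝ) (α : Fin r → Fin n → ℝ) : Prop :=
  (∀ j, lam j ≠ 0) ∧ p = ∑ j, MvPolynomial.C (lam j) * linearForm (α j) ^ d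

/-- Honesty: the linear forms are pairwise distinct, i.e. pairwise non-proportional
(for `d ≥ 1` this is the same as non-proportionality of their `d`-th powers). -/
def IsHonest {n r : ℕ} (α : Fin r → Fin n → ℝ) : Prop :=
  ∀ j k, j ≠ k → LinearIndependent ℝ ![α j, α k]

/-- The set of badges `(a, b)` of honest representations of `p` as a linear combination of `d`-th
powers of real linear forms: `a` coefficients are positive and `b` are negative. -/
def badges {n : ℕ} (d : ℕ) (p : MvPolynomial (Fin n) ℝ) : Set (ℕ × ℕ) :=
  {ab | ∃ (r : ℕ) (lam : Fin r → ℝ) (α : Fin r → Fin n → ℝ),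
    IsRepresentation d p lam α ∧ IsHonest α ∧
    ab.1 = Nat.card {j // 0 < lam j} ∧ ab.2 = Nat.card {j // lam j < 0}}

/-- The signatures of `p`: the minimal badges for the componentwise order on `ℕ × ℕ`. -/
def signatures {n : ℕ} (d : ℕ) (p : MvPolynomial (Fin n) ℝ) : Set (ℕ × ℕ) :=
  {ab | Minimal (fun x => x ∈ badges d p) ab}

end BinaryForms

/-! Two facts carry the proof. If `c < a`, then `b + c > s`: otherwise some nonnegative form of
degree `2s` vanishes exactly at the negative directions of the first representation and the positive
ones of the second. Paired apolarly with `p` it gives a value both `≥ 0` and `≤ 0`, so all terms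
vanish and the `a` positive directions of the first lie among the `c` positive ones of the second
(`lt_negative_add_positive`).

A definite signature `(a, 0)` has `a ≤ s + 1`: Gauss quadrature rewrites any `s + 2` powers as `s +
1` (`isSumPow_reduce`). Hence `b = 0` would give `s + 1 ≤ c < a ≤ s + 1`; `c = 0` is excluded by
passing to `-p`. The rest is arithmetic. -/

namespace BinaryForms

open Finset

/-! ### Apolar pairing and the bound on `b + c` -/

section Pairing

/-- The determinant of two vectors of the plane. -/
def det₂ (α β : Fin 2 → ℝ) : ℝ := α 0 * β 1 - α 1 * β 0

theorem linearIndependent_pair_iff_det₂_ne_zero (α β : Fin 2 → ℝ) :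
    LinearIndependent ℝ ![α, β] ↔ det₂ α β ≠ 0 := by
  have h := Matrix.linearIndependent_rows_iff_isUnit (K := ℝ) (A := Matrix.of ![α, β])
  rw [Matrix.isUnit_iff_isUnit_det, isUnit_iff_ne_zero, Matrix.det_fin_two] at h
  exact h

theorem det₂_eq_zero_of_common {α β γ : Fin 2 → ℝ} (hγ : γ ≠ 0) (hα : det₂ γ α = 0)
    (hβ : det₂ γ β = 0) : det₂ α β = 0 := by
  unfold det₂ at *
  by_cases h0 : γ 0 = 0
  · have h1 : γ 1 ≠ 0 := fun h1 => hγ (by ext i; fin_cases i <;> simp [h0, h1])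
    simp only [h0, zero_mul, zero_sub, neg_eq_zero, mul_eq_zero, h1, false_or] at hα hβ
    simp [hα, hβ]
  · have : γ 0 * (α 0 * β 1 - α 1 * β 0) = 0 := by linear_combination α 0 * hβ - β 0 * hα
    exact (mul_eq_zero.1 this).resolve_left h0

theorem linearForm_isHomogeneous {n : ℕ} (α : Fin n → ℝ) : (linearForm α).IsHomogeneous 1 :=
  MvPolynomial.IsHomogeneous.sum _ _ _ fun i _ => by
    simpa using (MvPolynomial.isHomogeneous_C (Fin n) (α i)).mul (MvPolynomial.isHomogeneous_X ℝ i)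

theorem eval_linearForm {n : ℕ} (α v : Fin n → ℝ) :
    MvPolynomial.eval v (linearForm α) = ∑ i, α i * v i := by
  simp [linearForm]

theorem linearForm_add {n : ℕ} (α β : Fin n → ℝ) :
    linearForm (α + β) = linearForm α + linearForm β := by
  simp [linearForm, add_mul, Finset.sum_add_distrib]

theorem linearForm_smul {n : ℕ} (c : ℝ) (α : Fin n → ℝ) :
    linearForm (c • α) = MvPolynomial.C c * linearForm α := by
  simp [linearForm, Finset.mul_sum, mul_assoc]

/-- The moments of the coefficient vectors are determined by the sum of powers. -/
theorem moment_eq {r r' n : ℕ} {lam : Fin r → ℝ} {α : Fin r → Fin 2 → ℝ}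
    {mu : Fin r' → ℝ} {β : Fin r' → Fin 2 → ℝ}
    (h : ∑ j, MvPolynomial.C (lam j) * linearForm (α j) ^ n =
      ∑ j, MvPolynomial.C (mu j) * linearForm (β j) ^ n) (k : ℕ) (hk : k ≤ n) :
    ∑ j, lam j * (α j 0 ^ k * α j 1 ^ (n - k)) = ∑ j, mu j * (β j 0 ^ k * β j 1 ^ (n - k)) := by
  -- Dehomogenizing by `y = 1` exposes each moment as a coefficient, up to a nonzero binomial.
  have key : ∀ γ : Fin 2 → ℝ, (MvPolynomial.aeval ![(Polynomial.X : Polynomial ℝ), 1]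
      (linearForm γ ^ n)).coeff k = n.choose k * (γ 0 ^ k * γ 1 ^ (n - k)) := by
    intro γ
    have h1 : MvPolynomial.aeval ![(Polynomial.X : Polynomial ℝ), 1] (linearForm γ ^ n) =
        (Polynomial.C (γ 0) * Polynomial.X + Polynomial.C (γ 1)) ^ n := by
      simp [linearForm, Fin.sum_univ_two, MvPolynomial.algHom_C]
    rw [h1, add_pow, Polynomial.finsetSum_coeff, Finset.sum_eq_single k]
    · rw [mul_pow, ← Polynomial.C_pow, ← Polynomial.C_pow, ← Polynomial.C_eq_natCast,
        show Polynomial.C (γ 0 ^ k) * Polynomial.X ^ k * Polynomial.C (γ 1 ^ (n - k)) *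
          Polynomial.C (n.choose k : ℝ) = Polynomial.C (n.choose k * (γ 0 ^ k * γ 1 ^ (n - k))) *
            Polynomial.X ^ k by simp only [Polynomial.C_mul]; ring, Polynomial.coeff_C_mul_X_pow]
      simp
    · intro b _ hb
      rw [mul_pow, ← Polynomial.C_pow, ← Polynomial.C_pow, ← Polynomial.C_eq_natCast,
        show Polynomial.C (γ 0 ^ b) * Polynomial.X ^ b * Polynomial.C (γ 1 ^ (n - b)) *
          Polynomial.C (n.choose b : ℝ) = Polynomial.C (n.choose b * (γ 0 ^ b * γ 1 ^ (n - b))) *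
            Polynomial.X ^ b by simp only [Polynomial.C_mul]; ring, Polynomial.coeff_C_mul_X_pow]
      simp [hb.symm]
    · intro h
      exact absurd (Finset.mem_range.2 (Nat.lt_succ_of_le hk)) h
  have h2 := congrArg (fun q => (MvPolynomial.aeval ![(Polynomial.X : Polynomial ℝ), 1] q).coeff k) h
  simp only [map_sum, map_mul, MvPolynomial.algHom_C, Polynomial.finsetSum_coeff,
    Polynomial.algebraMap_eq, Polynomial.coeff_C_mul, key] at h2
  have hc : (n.choose k : ℝ) ≠ 0 := by exact_mod_cast (Nat.choose_pos hk).ne'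
  apply mul_left_cancel₀ hc
  rw [Finset.mul_sum, Finset.mul_sum]
  convert h2 using 2 <;> ring

/-- Apolar pairing: a homogeneous form of degree `n` can be tested against two representations
of the same form as combinations of `n`-th powers. -/
theorem sum_eval_eq {r r' n : ℕ} {lam : Fin r → ℝ} {α : Fin r → Fin 2 → ℝ}
    {mu : Fin r' → ℝ} {β : Fin r' → Fin 2 → ℝ}
    (h : ∑ j, MvPolynomial.C (lam j) * linearForm (α j) ^ n =
      ∑ j, MvPolynomial.C (mu j) * linearForm (β j) ^ n)
    {Q : MvPolynomial (Fin 2) ℝ} (hQ : Q.IsHomogeneous n) :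
    ∑ j, lam j * MvPolynomial.eval (α j) Q = ∑ j, mu j * MvPolynomial.eval (β j) Q := by
  have expand : ∀ {m : ℕ} (c : Fin m → ℝ) (γ : Fin m → Fin 2 → ℝ),
      ∑ j, c j * MvPolynomial.eval (γ j) Q =
        ∑ e ∈ Q.support, Q.coeff e * ∑ j, c j * (γ j 0 ^ e 0 * γ j 1 ^ (n - e 0)) := by
    intro m c γ
    simp only [MvPolynomial.eval_eq', Finset.mul_sum]
    rw [Finset.sum_comm]
    refine Finset.sum_congr rfl fun e he => Finset.sum_congr rfl fun j _ => ?_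
    have hd : e 0 + e 1 = n := by
      have := hQ (MvPolynomial.mem_support_iff.1 he)
      rw [Finsupp.weight_apply, Finsupp.sum_fintype _ _ (by simp), Fin.sum_univ_two] at this
      simpa using this
    rw [Fin.prod_univ_two, ← hd, Nat.add_sub_cancel_left]
    ring
  rw [expand, expand]
  refine Finset.sum_congr rfl fun e he => ?_
  have hd : e 0 ≤ n := by
    have := hQ (MvPolynomial.mem_support_iff.1 he)
    rw [Finsupp.weight_apply, Finsupp.sum_fintype _ _ (by simp), Fin.sum_univ_two] at this
    simp at this
    omega
  rw [moment_eq h _ hd]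

/-- A nonnegative form of degree `2 s` whose nonzero zeros are the points of at most `s` given
directions. -/
theorem exists_form_vanishing {ι : Type*} (T : Finset ι) (γ : ι → Fin 2 → ℝ) {s : ℕ}
    (hT : #T ≤ s) : ∃ Q : MvPolynomial (Fin 2) ℝ, Q.IsHomogeneous (2 * s) ∧
      (∀ v, 0 ≤ MvPolynomial.eval v Q) ∧ (∀ i ∈ T, MvPolynomial.eval (γ i) Q = 0) ∧
      ∀ v, v ≠ 0 → MvPolynomial.eval v Q = 0 → ∃ i ∈ T, det₂ (γ i) v = 0 := by
  -- Squares of the `D i` give the zeros without sign changes; the definite `N` pads the degree to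
  -- `2 s` without adding zeros.
  set D : ι → MvPolynomial (Fin 2) ℝ := fun i => linearForm ![-γ i 1, γ i 0]
  set N : MvPolynomial (Fin 2) ℝ := MvPolynomial.X 0 ^ 2 + MvPolynomial.X 1 ^ 2
  have hD : ∀ i v, MvPolynomial.eval v (D i) = det₂ (γ i) v := by
    intro i v
    simp [D, eval_linearForm, Fin.sum_univ_two, det₂]
    ring
  have hN : ∀ v, MvPolynomial.eval v N = v 0 ^ 2 + v 1 ^ 2 := by simp [N]
  have hev : ∀ v, MvPolynomial.eval v ((∏ i ∈ T, D i ^ 2) * N ^ (s - #T)) =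
      (∏ i ∈ T, det₂ (γ i) v ^ 2) * (v 0 ^ 2 + v 1 ^ 2) ^ (s - #T) := by
    intro v
    simp only [map_mul, map_prod, map_pow, hD, hN]
  refine ⟨(∏ i ∈ T, D i ^ 2) * N ^ (s - #T), ?_, ?_, ?_, ?_⟩
  · have h1 : (∏ i ∈ T, D i ^ 2).IsHomogeneous (∑ i ∈ T, 1 * 2) :=
      MvPolynomial.IsHomogeneous.prod _ _ _ fun i _ => (linearForm_isHomogeneous _).pow 2
    have h2 : N.IsHomogeneous 2 :=
      (by simpa using (MvPolynomial.isHomogeneous_X ℝ (0 : Fin 2)).pow 2 :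
        (MvPolynomial.X 0 ^ 2 : MvPolynomial (Fin 2) ℝ).IsHomogeneous 2).add
      (by simpa using (MvPolynomial.isHomogeneous_X ℝ (1 : Fin 2)).pow 2)
    have h3 := h1.mul (h2.pow (s - #T))
    convert h3 using 1
    simp
    omega
  · intro v
    rw [hev]
    exact mul_nonneg (Finset.prod_nonneg fun _ _ => sq_nonneg _) (by positivity)
  · intro i hi
    rw [hev, Finset.prod_eq_zero hi (by simp [det₂, mul_comm]), zero_mul]
  · intro v hv h
    rw [hev, mul_eq_zero] at h
    rcases h with h | h
    · obtain ⟨i, hi, h⟩ := Finset.prod_eq_zero_iff.1 h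
      exact ⟨i, hi, by simpa using h⟩
    · exfalso
      have h := eq_zero_of_pow_eq_zero h
      apply hv
      ext i
      fin_cases i
      · simp; nlinarith [sq_nonneg (v 0), sq_nonneg (v 1)]
      · simp; nlinarith [sq_nonneg (v 0), sq_nonneg (v 1)]

theorem zero_mem_badges_zero {n d : ℕ} : ((0, 0) : ℕ × ℕ) ∈ badges d (0 : MvPolynomial (Fin n) ℝ) :=
  ⟨0, Fin.elim0, Fin.elim0, ⟨fun j => j.elim0, by simp⟩, fun j => j.elim0, by simp, by simp⟩

/-- In an honest representation of a nonzero form no linear form vanishes. -/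
theorem IsHonest.ne_zero {n r d : ℕ} (hd : d ≠ 0) {p : MvPolynomial (Fin n) ℝ} (hp : p ≠ 0)
    {lam : Fin r → ℝ} {α : Fin r → Fin n → ℝ} (hr : IsRepresentation d p lam α)
    (h : IsHonest α) (j : Fin r) : α j ≠ 0 := by
  intro hj
  apply hp
  rw [hr.2]
  refine Finset.sum_eq_zero fun k _ => ?_
  have hkj : k = j := by
    by_contra hk
    exact (h j k (Ne.symm hk)).ne_zero 0 hj
  rw [hkj, hj]
  simp [linearForm, hd]

/-- If the number of positive terms of one honest representation exceeds that of another one, then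
the negative terms of the first and the positive terms of the second number more than `s`. -/
theorem lt_negative_add_positive {s : ℕ} (hs : s ≠ 0) {p : MvPolynomial (Fin 2) ℝ} (hp : p ≠ 0)
    {a b c d : ℕ} (hab : (a, b) ∈ badges (2 * s) p) (hcd : (c, d) ∈ badges (2 * s) p)
    (hac : c < a) : s < b + c := by
  obtain ⟨r, lam, α, hr, hα, ha, hb⟩ := hab
  obtain ⟨r', mu, β, hr', hβ, hc, hd⟩ := hcd
  simp only [Nat.card_eq_fintype_card, Fintype.card_subtype] at ha hb hc hd
  by_contra! hle
  have hα0 := hα.ne_zero (by omega) hp hr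
  have hβ0 := hβ.ne_zero (by omega) hp hr'
  obtain ⟨Q, hQ, hQ0, hQT, hQz⟩ := exists_form_vanishing
    (({j | lam j < 0} : Finset (Fin r)).disjSum ({j | 0 < mu j} : Finset (Fin r')))
    (Sum.elim α β) (s := s) (by rw [Finset.card_disjSum]; omega)
  have heq := sum_eval_eq (hr.2.symm.trans hr'.2) hQ
  have hpos : ∀ j, 0 ≤ lam j * MvPolynomial.eval (α j) Q := by
    intro j
    rcases lt_or_ge (lam j) 0 with h | h
    · rw [show MvPolynomial.eval (α j) Q = 0 from hQT (Sum.inl j) (by simpa using h), mul_zero]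
    · exact mul_nonneg h (hQ0 _)
  have hneg : ∀ j, mu j * MvPolynomial.eval (β j) Q ≤ 0 := by
    intro j
    rcases lt_or_ge 0 (mu j) with h | h
    · rw [show MvPolynomial.eval (β j) Q = 0 from hQT (Sum.inr j) (by simpa using h), mul_zero]
    · exact mul_nonpos_of_nonpos_of_nonneg h (hQ0 _)
  have hz : ∑ j, lam j * MvPolynomial.eval (α j) Q = 0 :=
    le_antisymm (heq ▸ Finset.sum_nonpos fun j _ => hneg j) (Finset.sum_nonneg fun j _ => hpos j)
  rw [Finset.sum_eq_zero_iff_of_nonneg fun j _ => hpos j] at hz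
  have hex : ∀ j, 0 < lam j → ∃ k, 0 < mu k ∧ det₂ (β k) (α j) = 0 := by
    intro j hj
    obtain ⟨i, hi, hdet⟩ := hQz (α j) (hα0 j)
      ((mul_eq_zero.1 (hz j (Finset.mem_univ _))).resolve_left hj.ne')
    rcases i with i | k
    · simp only [Finset.inl_mem_disjSum, Finset.mem_filter_univ] at hi
      have hij : i ≠ j := by rintro rfl; exact lt_asymm hi hj
      exact absurd hdet ((linearIndependent_pair_iff_det₂_ne_zero _ _).1 (hα i j hij))
    · exact ⟨k, by simpa using hi, hdet⟩
  -- By honesty, no `β k` is proportional to two different `α j`.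
  have hcard : #({j | 0 < lam j} : Finset (Fin r)) ≤ #({j | 0 < mu j} : Finset (Fin r')) := by
    refine Finset.card_le_card_of_forall_subsingleton (fun j k => det₂ (β k) (α j) = 0)
      (fun j hj => ?_) fun k _ i hi j hj => ?_
    · simpa using hex j (by simpa using hj)
    · by_contra hne
      exact (linearIndependent_pair_iff_det₂_ne_zero _ _).1 (hα i j hne)
        (det₂_eq_zero_of_common (hβ0 k) hi.2 hj.2)
  omega

end Pairing

/-! ### Gauss quadrature for finitely many nodes -/

section Quadrature

open Polynomial

/-- Consecutive nodal products have opposite signs. -/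
theorem prod_sub_mul_prod_sub_neg {n : ℕ} {t : Fin (n + 1) → ℝ} (ht : StrictMono t) (j : Fin n) :
    (∏ i ∈ univ.erase j.castSucc, (t j.castSucc - t i)) *
      (∏ i ∈ univ.erase j.succ, (t j.succ - t i)) < 0 := by
  have hlt : t j.castSucc < t j.succ := ht Fin.castSucc_lt_succ
  have hne : j.castSucc ≠ j.succ := Fin.castSucc_lt_succ.ne
  rw [← Finset.mul_prod_erase (univ.erase j.castSucc) _ (a := j.succ) (by simp [hne.symm]),
    ← Finset.mul_prod_erase (univ.erase j.succ) _ (a := j.castSucc) (by simp [hne]),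
    Finset.erase_right_comm (a := j.succ)]
  -- No other node lies between the two neighbours, so only their mutual differences contribute a
  -- negative sign.
  have hpos : 0 < ∏ i ∈ (univ.erase j.castSucc).erase j.succ,
      ((t j.castSucc - t i) * (t j.succ - t i)) := by
    refine Finset.prod_pos fun i hi => ?_
    simp only [Finset.mem_erase, Finset.mem_univ, and_true] at hi
    rcases lt_or_ge i j.castSucc with h | h
    · have h1 := ht h
      exact mul_pos (by linarith) (by linarith)
    · have h2 : j.succ < i := lt_of_le_of_ne
        (Fin.castSucc_lt_iff_succ_le.1 (lt_of_le_of_ne h (Ne.symm hi.2))) (Ne.symm hi.1)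
      have h3 := ht h2
      exact mul_pos_of_neg_of_neg (by linarith) (by linarith)
  rw [Finset.prod_mul_distrib] at hpos
  have : (t j.castSucc - t j.succ) * (t j.succ - t j.castSucc) < 0 :=
    mul_neg_of_neg_of_pos (by linarith) (by linarith)
  nlinarith

/-- A polynomial which alternates in sign along `n + 1` nodes has `n` distinct roots. -/
theorem exists_roots_of_alternating {n : ℕ} {t : Fin (n + 1) → ℝ} (ht : StrictMono t) {K : ℝ[X]}
    (hK : ∀ j : Fin n, K.eval (t j.castSucc) * K.eval (t j.succ) < 0) :
    ∃ u : Fin n → ℝ, Function.Injective u ∧ ∀ j, K.eval (u j) = 0 := by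
  have hex : ∀ j : Fin n, ∃ x ∈ Set.Ioo (t j.castSucc) (t j.succ), K.eval x = 0 := by
    intro j
    have hle : t j.castSucc ≤ t j.succ := (ht Fin.castSucc_lt_succ).le
    rcases mul_neg_iff.1 (hK j) with h | h
    · exact intermediate_value_Ioo' hle K.continuous.continuousOn ⟨h.2, h.1⟩
    · exact intermediate_value_Ioo hle K.continuous.continuousOn ⟨h.1, h.2⟩
  choose u hu hu0 using hex
  refine ⟨u, StrictMono.injective fun i j hij => ?_, hu0⟩
  calc u i < t i.succ := (hu i).2
    _ ≤ t j.castSucc := ht.monotone (by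
        rw [Fin.le_def]; simp only [Fin.val_succ, Fin.val_castSucc]; exact hij)
    _ < u j := (hu j).1

/-- Gauss quadrature for a positive measure on `n + 1` points: it has the same moments up to order
`2 n - 1` as a nonnegative measure on `n` points, whose moment of order `2 n` is not larger. -/
theorem exists_quadrature_of_strictMono {n : ℕ} {t w : Fin (n + 1) → ℝ} (ht : StrictMono t)
    (hw : ∀ i, 0 < w i) : ∃ (u v : Fin n → ℝ) (g : ℝ), (∀ j, 0 ≤ v j) ∧ 0 ≤ g ∧
      ∀ f : ℝ[X], f.natDegree ≤ 2 * n →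
        ∑ i, w i * f.eval (t i) = ∑ j, v j * f.eval (u j) + g * f.coeff (2 * n) := by
  set om : Fin (n + 1) → ℝ := fun i => ∏ k ∈ univ.erase i, (t i - t k) with hom
  have hom0 : ∀ i, om i ≠ 0 := fun i => Finset.prod_ne_zero_iff.2 fun k hk =>
    sub_ne_zero.2 fun h => (Finset.mem_erase.1 hk).1 (ht.injective h).symm
  have htinj : Set.InjOn t (univ : Finset (Fin (n + 1))) := ht.injective.injOn
  -- `K` is, up to scale, the degree `n` orthogonal polynomial of the measure: with these values, `∑
  -- w i * K (t i) * q (t i)` is the divided difference of `q`, which is zero when `deg q < n`.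
  set K : ℝ[X] := Lagrange.interpolate univ t fun i => (w i * om i)⁻¹ with hKdef
  have hKt : ∀ i, K.eval (t i) = (w i * om i)⁻¹ := fun i =>
    Lagrange.eval_interpolate_at_node _ htinj (Finset.mem_univ i)
  have hKdeg : K.natDegree ≤ n := by
    have := Lagrange.degree_interpolate_le (fun i => (w i * om i)⁻¹) htinj
    rw [← hKdef] at this
    exact natDegree_le_of_degree_le (by simpa using this)
  obtain ⟨u, hu, hu0⟩ := exists_roots_of_alternating ht (K := K) fun j => by
    rw [hKt, hKt, ← mul_inv, inv_lt_zero,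
      show w j.castSucc * om j.castSucc * (w j.succ * om j.succ) =
        (w j.castSucc * w j.succ) * (om j.castSucc * om j.succ) by ring]
    exact mul_neg_of_pos_of_neg (mul_pos (hw _) (hw _)) (prod_sub_mul_prod_sub_neg ht j)
  have hKt0 : ∀ i, K.eval (t i) ≠ 0 := fun i => by
    rw [hKt]; exact inv_ne_zero (mul_ne_zero (hw i).ne' (hom0 i))
  set R : ℝ[X] := Lagrange.nodal univ u with hR
  obtain ⟨e, he⟩ : ∃ e : ℝ, K = C e * R := by
    obtain ⟨q, hq⟩ : R ∣ K := by
      rw [hR, Lagrange.nodal_eq]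
      refine Finset.prod_dvd_of_coprime (fun i _ j _ hij => ?_) fun j _ => dvd_iff_isRoot.2 (hu0 j)
      exact pairwise_coprime_X_sub_C hu hij
    have hK0 : K ≠ 0 := fun h => hKt0 0 (by simp [h])
    have hq0 : q ≠ 0 := by rintro rfl; exact hK0 (by simpa using hq)
    have hqd : q.natDegree = 0 := by
      have h := natDegree_mul (p := R) (q := q) (Lagrange.nodal_ne_zero) hq0
      rw [← hq, hR, Lagrange.natDegree_nodal, Finset.card_univ, Fintype.card_fin] at h
      omega
    rw [natDegree_eq_zero] at hqd
    obtain ⟨e, rfl⟩ := hqd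
    exact ⟨e, by rw [hq, mul_comm]⟩
  have he0 : e ≠ 0 := by rintro rfl; exact hKt0 0 (by simp [he])
  have hRt : ∀ x, R.eval x = ∏ j, (x - u j) := fun x => by rw [hR, Lagrange.eval_nodal]
  have htu : ∀ i j, t i ≠ u j := fun i j h => hKt0 i (by rw [h, hu0])
  set x : Fin (n + 1) ⊕ Fin n → ℝ := Sum.elim t u with hx
  have hxinj : Function.Injective x :=
    Function.Injective.sumElim ht.injective hu htu
  set v : Fin n → ℝ := fun j =>
    -(e * ∏ k ∈ univ.erase (Sum.inr j), (x (Sum.inr j) - x k))⁻¹ with hv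
  have hmain : ∀ f : ℝ[X], f.natDegree ≤ 2 * n →
      ∑ i, w i * f.eval (t i) = ∑ j, v j * f.eval (u j) + e⁻¹ * f.coeff (2 * n) := by
    intro f hf
    -- The divided difference of `f` over all `2 n + 1` nodes is its coefficient at `2 n`; the
    -- choice of `K` makes the weights at the `t i` equal to `e * w i`.
    have hcard : #(univ : Finset (Fin (n + 1) ⊕ Fin n)) = 2 * n + 1 := by
      simp; omega
    have h := Lagrange.coeff_eq_sum (s := univ) (v := x) hxinj.injOn (P := f)
      (by rw [hcard]; exact (degree_le_of_natDegree_le hf).trans_lt (by exact_mod_cast Nat.lt_succ_self _))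
    rw [hcard, Nat.add_sub_cancel, Fintype.sum_sum_type] at h
    rw [h, mul_add, Finset.mul_sum, Finset.mul_sum]
    have h1 : ∀ i, e⁻¹ * (f.eval (x (Sum.inl i)) /
        ∏ k ∈ univ.erase (Sum.inl i), (x (Sum.inl i) - x k)) = w i * f.eval (t i) := by
      intro i
      have hp : ∏ k ∈ univ.erase (Sum.inl i), (x (Sum.inl i) - x k) = om i * R.eval (t i) := by
        rw [hRt, hom]
        have : (univ.erase (Sum.inl i) : Finset (Fin (n + 1) ⊕ Fin n)) =
            (univ.erase i).disjSum univ := by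
          ext k; rcases k with k | k <;> simp
        rw [this, Finset.prod_disjSum]
        rfl
      have hKR : e * R.eval (t i) = (w i * om i)⁻¹ := by rw [← hKt i, he]; simp
      have hR0 : R.eval (t i) ≠ 0 := fun h => hKt0 i (by rw [he]; simp [h])
      have hw0 := (hw i).ne'
      have hom0' := hom0 i
      have h1 : e * R.eval (t i) * (w i * om i) = 1 := by
        rw [hKR, inv_mul_cancel₀ (mul_ne_zero hw0 hom0')]
      rw [hp, show x (Sum.inl i) = t i from rfl]
      field_simp
      linear_combination (-f.eval (t i)) * h1
    have h2 : ∀ j, e⁻¹ * (f.eval (x (Sum.inr j)) /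
        ∏ k ∈ univ.erase (Sum.inr j), (x (Sum.inr j) - x k)) = - (v j * f.eval (u j)) := by
      intro j
      rw [hv, show x (Sum.inr j) = u j from rfl, div_eq_mul_inv]
      simp only [mul_inv]
      rw [show x (Sum.inr j) = u j from rfl]
      ring
    simp only [h1, h2, Finset.sum_neg_distrib]
    ring
  refine ⟨u, v, e⁻¹, fun j => ?_, ?_, hmain⟩
  -- Testing on `g ^ 2` isolates `v j`; testing on `R ^ 2` below isolates `e⁻¹`.
  · set g : ℝ[X] := Lagrange.nodal (univ.erase j) u with hg
    have hgd : g.natDegree = n - 1 := by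
      rw [hg, Lagrange.natDegree_nodal, Finset.card_erase_of_mem (Finset.mem_univ _)]; simp
    have hg0 : ∀ k, k ≠ j → g.eval (u k) = 0 := fun k hk =>
      Lagrange.eval_nodal_at_node (by simp [hk])
    have hgj : g.eval (u j) ≠ 0 := Lagrange.eval_nodal_not_at_node fun k hk h =>
      (Finset.mem_erase.1 hk).1 (hu h).symm
    have hn : 0 < n := Fin.pos j
    have hlt : (g ^ 2).natDegree < 2 * n := by rw [natDegree_pow, hgd]; omega
    have h := hmain (g ^ 2) hlt.le
    rw [coeff_eq_zero_of_natDegree_lt hlt, mul_zero, add_zero, Finset.sum_eq_single j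
      (fun k _ hk => by simp [hg0 k hk]) (by simp)] at h
    have hge : 0 ≤ ∑ i, w i * (g ^ 2).eval (t i) := Finset.sum_nonneg fun i _ =>
      mul_nonneg (hw i).le (by rw [eval_pow]; exact sq_nonneg _)
    rw [h, eval_pow] at hge
    exact nonneg_of_mul_nonneg_left hge (by positivity)
  · have hm : (R ^ 2).Monic := (Lagrange.nodal_monic).pow 2
    have hRd : (R ^ 2).natDegree = 2 * n := by
      rw [natDegree_pow, hR, Lagrange.natDegree_nodal]; simp
    have h := hmain (R ^ 2) hRd.le
    have hc : (R ^ 2).coeff (2 * n) = 1 := by rw [← hRd]; exact hm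
    rw [hc, mul_one, Finset.sum_eq_zero (s := univ) (f := fun j => v j * (R ^ 2).eval (u j))
      (fun j _ => by
        rw [eval_pow, hR, Lagrange.eval_nodal_at_node (Finset.mem_univ j)]; simp), zero_add] at h
    rw [← h]
    exact Finset.sum_nonneg fun i _ =>
      mul_nonneg (hw i).le (by rw [eval_pow]; exact sq_nonneg _)

theorem exists_quadrature {n : ℕ} {t w : Fin (n + 1) → ℝ} (ht : Function.Injective t)
    (hw : ∀ i, 0 < w i) : ∃ (u v : Fin n → ℝ) (g : ℝ), (∀ j, 0 ≤ v j) ∧ 0 ≤ g ∧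
      ∀ f : ℝ[X], f.natDegree ≤ 2 * n →
        ∑ i, w i * f.eval (t i) = ∑ j, v j * f.eval (u j) + g * f.coeff (2 * n) := by
  set σ := Tuple.sort t
  obtain ⟨u, v, g, hv, hg, h⟩ := exists_quadrature_of_strictMono (t := t ∘ σ) (w := w ∘ σ)
    ((Tuple.monotone_sort t).strictMono_of_injective (ht.comp σ.injective)) fun i => hw _
  refine ⟨u, v, g, hv, hg, fun f hf => ?_⟩
  rw [← h f hf]
  exact (Equiv.sum_comp σ fun i => w i * f.eval (t i)).symm

end Quadrature

/-! ### Shortening sums of even powers -/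

section SumsOfPowers

/-- `p` is a sum of `r` (possibly proportional or zero) `d`-th powers of binary linear forms. -/
def IsSumPow (d r : ℕ) (p : MvPolynomial (Fin 2) ℝ) : Prop :=
  ∃ α : Fin r → Fin 2 → ℝ, p = ∑ j, linearForm (α j) ^ d

theorem IsSumPow.add {d r r' : ℕ} {p q : MvPolynomial (Fin 2) ℝ} (hp : IsSumPow d r p)
    (hq : IsSumPow d r' q) : IsSumPow d (r + r') (p + q) := by
  obtain ⟨α, rfl⟩ := hp
  obtain ⟨β, rfl⟩ := hq
  exact ⟨Fin.append α β, by simp [Fin.sum_univ_add]⟩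

theorem exists_linearForm_pow_eq {s : ℕ} (hs : s ≠ 0) {c : ℝ} (hc : 0 ≤ c) (α : Fin 2 → ℝ) :
    ∃ β, MvPolynomial.C c * linearForm α ^ (2 * s) = linearForm β ^ (2 * s) := by
  refine ⟨(c ^ ((2 * s : ℕ) : ℝ)⁻¹) • α, ?_⟩
  rw [linearForm_smul, mul_pow, ← MvPolynomial.C_pow, Real.rpow_inv_natCast_pow hc (by omega)]

theorem isSumPow_sum {s r : ℕ} (hs : s ≠ 0) {c : Fin r → ℝ} (hc : ∀ j, 0 ≤ c j)
    (α : Fin r → Fin 2 → ℝ) :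
    IsSumPow (2 * s) r (∑ j, MvPolynomial.C (c j) * linearForm (α j) ^ (2 * s)) := by
  choose β hβ using fun j => exists_linearForm_pow_eq hs (hc j) (α j)
  exact ⟨β, Finset.sum_congr rfl fun j _ => hβ j⟩

theorem isSumPow_one {s : ℕ} (hs : s ≠ 0) {c : ℝ} (hc : 0 ≤ c) (α : Fin 2 → ℝ) :
    IsSumPow (2 * s) 1 (MvPolynomial.C c * linearForm α ^ (2 * s)) := by
  simpa using isSumPow_sum (r := 1) hs (fun _ => hc) fun _ => α

/-- Two powers of dependent linear forms merge into one. -/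
theorem isSumPow_one_of_det₂_eq_zero {s : ℕ} (hs : s ≠ 0) {α β : Fin 2 → ℝ} (h : det₂ α β = 0) :
    IsSumPow (2 * s) 1 (linearForm α ^ (2 * s) + linearForm β ^ (2 * s)) := by
  by_cases hα : α = 0
  · subst hα
    have := isSumPow_one hs zero_le_one β
    simpa [linearForm, hs] using this
  · have hdep : ¬ LinearIndependent ℝ ![α, β] := fun hl =>
      (linearIndependent_pair_iff_det₂_ne_zero _ _).1 hl h
    rw [LinearIndependent.pair_iff' hα] at hdep
    push Not at hdep
    obtain ⟨c, rfl⟩ := hdep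
    have := isSumPow_one hs (c := 1 + c ^ (2 * s)) (by rw [pow_mul]; positivity) α
    rw [linearForm_smul, mul_pow, ← MvPolynomial.C_pow]
    simpa [add_mul] using this

theorem sum_eq_add_add {r : ℕ} {M : Type*} [AddCommMonoid M] (f : Fin (r + 2) → M)
    {j k : Fin (r + 2)} (hjk : j ≠ k) :
    ∃ e : Fin r → Fin (r + 2), ∑ i, f i = (f j + f k) + ∑ i, f (e i) := by
  obtain ⟨k, rfl⟩ := Fin.exists_succAbove_eq hjk.symm
  exact ⟨fun i => j.succAbove (k.succAbove i), by
    rw [Fin.sum_univ_succAbove f j, Fin.sum_univ_succAbove _ k, add_assoc]⟩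

theorem IsSumPow.merge {s r : ℕ} (hs : s ≠ 0) {α : Fin (r + 2) → Fin 2 → ℝ} {j k : Fin (r + 2)}
    (hjk : j ≠ k) (h : det₂ (α j) (α k) = 0) :
    IsSumPow (2 * s) (r + 1) (∑ i, linearForm (α i) ^ (2 * s)) := by
  obtain ⟨e, he⟩ := sum_eq_add_add (fun i => linearForm (α i) ^ (2 * s)) hjk
  rw [he, add_comm r 1]
  exact (isSumPow_one_of_det₂_eq_zero hs h).add ⟨_, rfl⟩

/-- The quadrature of the binomial expansion. -/
theorem sum_add_pow_eq {n : ℕ} {t w : Fin (n + 1) → ℝ} {u v : Fin n → ℝ} {g : ℝ}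
    (h : ∀ f : Polynomial ℝ, f.natDegree ≤ 2 * n →
      ∑ i, w i * f.eval (t i) = ∑ j, v j * f.eval (u j) + g * f.coeff (2 * n))
    (l m : MvPolynomial (Fin 2) ℝ) :
    ∑ i, MvPolynomial.C (w i) * (MvPolynomial.C (t i) * l + m) ^ (2 * n) =
      ∑ j, MvPolynomial.C (v j) * (MvPolynomial.C (u j) * l + m) ^ (2 * n) +
        MvPolynomial.C g * l ^ (2 * n) := by
  -- Only moments of order at most `2 n` enter; the top one yields the term in `g`.
  have expand : ∀ {q : ℕ} (c x : Fin q → ℝ),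
      ∑ i, MvPolynomial.C (c i) * (MvPolynomial.C (x i) * l + m) ^ (2 * n) =
        ∑ k ∈ Finset.range (2 * n + 1), MvPolynomial.C (∑ i, c i * x i ^ k) *
          (l ^ k * m ^ (2 * n - k) * ((2 * n).choose k : MvPolynomial (Fin 2) ℝ)) := by
    intro q c x
    simp only [add_pow, map_sum, Finset.sum_mul, Finset.mul_sum]
    rw [Finset.sum_comm]
    refine Finset.sum_congr rfl fun k _ => Finset.sum_congr rfl fun i _ => ?_
    rw [MvPolynomial.C_mul, MvPolynomial.C_pow]
    ring
  rw [expand, expand, Finset.sum_range_succ, Finset.sum_range_succ _ (2 * n), add_assoc]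
  congr 1
  · refine Finset.sum_congr rfl fun k hk => ?_
    have hk := Finset.mem_range.1 hk
    have := h (Polynomial.X ^ k) (by simpa using hk.le)
    simp only [Polynomial.eval_pow, Polynomial.eval_X, Polynomial.coeff_X_pow, hk.ne', if_false,
      mul_zero, add_zero] at this
    rw [this]
  · have := h (Polynomial.X ^ (2 * n)) (by simp)
    simp only [Polynomial.eval_pow, Polynomial.eval_X, Polynomial.coeff_X_pow, if_true,
      mul_one] at this
    rw [this]
    simp [add_mul]

/-- A sum of `s + 2` powers of degree `2 s` is a sum of `s + 1` such powers. -/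
theorem isSumPow_reduce {s : ℕ} (hs : s ≠ 0) {p : MvPolynomial (Fin 2) ℝ}
    (hp : IsSumPow (2 * s) (s + 2) p) : IsSumPow (2 * s) (s + 1) p := by
  obtain ⟨α, rfl⟩ := hp
  by_cases hdep : ∃ j k, j ≠ k ∧ det₂ (α j) (α k) = 0
  · obtain ⟨j, k, hjk, h⟩ := hdep
    exact IsSumPow.merge hs hjk h
  push Not at hdep
  -- In the basis `α 0`, `α 1` (Cramer's rule), `α 0` is the point at infinity and the other `s + 1`
  -- forms are finite nodes `t i` with scale `c i`.
  set D := det₂ (α 0) (α 1) with hD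
  have hD0 : D ≠ 0 := hdep 0 1 (by simp)
  set c : Fin (s + 1) → ℝ := fun i => det₂ (α 0) (α i.succ) / D with hc
  set t : Fin (s + 1) → ℝ := fun i => det₂ (α i.succ) (α 1) / det₂ (α 0) (α i.succ) with ht
  have hi0 : ∀ i : Fin (s + 1), det₂ (α 0) (α i.succ) ≠ 0 := fun i =>
    hdep _ _ (Fin.succ_ne_zero i).symm
  have hc0 : ∀ i, c i ≠ 0 := fun i => div_ne_zero (hi0 i) hD0
  have hα : ∀ i : Fin (s + 1), α i.succ = c i • (t i • α 0 + α 1) := by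
    intro i
    have h1 := hi0 i
    have key : ∀ m, D * α i.succ m =
        det₂ (α i.succ) (α 1) * α 0 m + det₂ (α 0) (α i.succ) * α 1 m := by
      intro m
      fin_cases m <;> simp [hD, det₂] <;> ring
    ext m
    simp only [hc, ht, Pi.smul_apply, Pi.add_apply, smul_eq_mul]
    field_simp
    linear_combination key m
  have htinj : Function.Injective t := by
    intro i j hij
    by_contra hne
    apply hdep i.succ j.succ (fun h => hne (Fin.succ_injective _ h))
    rw [hα i, hα j, hij]
    simp [det₂]
    ring
  obtain ⟨u, v, g, hv, hg, hquad⟩ := exists_quadrature htinj (w := fun i => c i ^ (2 * s))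
    fun i => (even_two_mul s).pow_pos (hc0 i)
  have hsum := sum_add_pow_eq hquad (linearForm (α 0)) (linearForm (α 1))
  have heq : ∑ i, linearForm (α i) ^ (2 * s) =
      ∑ j, MvPolynomial.C (v j) * linearForm (u j • α 0 + α 1) ^ (2 * s) +
        -- The defect `g` of the top moment is absorbed at infinity, leaving `s` finite nodes and `α
        -- 0`.
        MvPolynomial.C (1 + g) * linearForm (α 0) ^ (2 * s) := by
    simp only [linearForm_add, linearForm_smul]
    rw [Fin.sum_univ_succ, MvPolynomial.C_add, add_mul, add_left_comm, ← hsum,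
      MvPolynomial.C_1, one_mul]
    congr 1
    refine Finset.sum_congr rfl fun i _ => ?_
    rw [hα i, linearForm_smul, linearForm_add, linearForm_smul, mul_pow, MvPolynomial.C_pow]
  rw [heq]
  exact (isSumPow_sum hs hv _).add (isSumPow_one hs (by linarith) _)

/-- A sum of powers of degree `2 s` has a badge without negative terms and with at most `s + 1`
positive ones. -/
theorem IsSumPow.exists_badge {s r : ℕ} (hs : s ≠ 0) {p : MvPolynomial (Fin 2) ℝ}
    (hp : IsSumPow (2 * s) r p) : ∃ m, m ≤ r ∧ m ≤ s + 1 ∧ (m, 0) ∈ badges (2 * s) p := by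
  classical
  have hex : ∃ m, IsSumPow (2 * s) m p := ⟨r, hp⟩
  -- In a shortest sum no two forms are proportional, since they would merge; so it is honest.
  set m := Nat.find hex with hm
  have hmin : ∀ k, IsSumPow (2 * s) k p → m ≤ k := fun k hk => Nat.find_min' hex hk
  obtain ⟨α, hα⟩ : IsSumPow (2 * s) m p := Nat.find_spec hex
  clear_value m
  refine ⟨m, hmin r hp, ?_, m, fun _ => 1, α, ⟨fun _ => one_ne_zero, by simpa using hα⟩,
    fun j k hjk => ?_, by simp, by simp [not_lt.2 (zero_le_one' ℝ)]⟩
  · by_contra! hlt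
    obtain ⟨k, rfl⟩ := Nat.exists_eq_add_of_le (show s + 2 ≤ m by omega)
    rw [Fin.sum_univ_add] at hα
    have := hmin _ (hα ▸ (isSumPow_reduce hs ⟨_, rfl⟩).add ⟨_, rfl⟩)
    omega
  · rw [linearIndependent_pair_iff_det₂_ne_zero]
    intro h
    have h2 : 2 ≤ m := by
      have := j.isLt
      have := k.isLt
      have : (j : ℕ) ≠ k := fun h => hjk (Fin.ext h)
      omega
    obtain ⟨q, rfl⟩ := Nat.exists_eq_add_of_le' h2
    have := hmin _ (hα ▸ IsSumPow.merge hs hjk h)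
    omega

/-- A signature without negative terms has at most `s + 1` positive ones. -/
theorem le_of_mem_signatures {s a : ℕ} (hs : s ≠ 0) {p : MvPolynomial (Fin 2) ℝ}
    (h : (a, 0) ∈ signatures (2 * s) p) : a ≤ s + 1 := by
  obtain ⟨r, lam, α, hr, -, ha, hb⟩ := h.prop
  have hpos : ∀ j, 0 < lam j := by
    intro j
    by_contra! hj
    have : Nonempty {j // lam j < 0} := ⟨j, lt_of_le_of_ne hj (hr.1 j)⟩
    exact Nat.card_pos.ne hb
  have har : a = r := by
    simp only [Nat.card_eq_fintype_card, Fintype.card_subtype, hpos] at ha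
    simpa using ha
  obtain ⟨m, hmr, hms, hmem⟩ : ∃ m, m ≤ r ∧ m ≤ s + 1 ∧ (m, 0) ∈ badges (2 * s) p :=
    IsSumPow.exists_badge hs (hr.2 ▸ isSumPow_sum hs (fun j => (hpos j).le) α)
  have := (h.le_of_le hmem ⟨har ▸ hmr, le_rfl⟩).1
  exact this.trans hms

end SumsOfPowers

/-! ### Exchange of signs under negation -/

section Symmetry

theorem swap_mem_badges_neg {n d : ℕ} {p : MvPolynomial (Fin n) ℝ} {a b : ℕ}
    (h : (a, b) ∈ badges d p) : (b, a) ∈ badges d (-p) := by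
  obtain ⟨r, lam, α, hr, hα, ha, hb⟩ := h
  exact ⟨r, fun j => -lam j, α, ⟨fun j => neg_ne_zero.2 (hr.1 j), by simp [hr.2]⟩, hα,
    by simpa using hb, by simpa using ha⟩

theorem swap_mem_signatures_neg {n d : ℕ} {p : MvPolynomial (Fin n) ℝ} {a b : ℕ}
    (h : (a, b) ∈ signatures d p) : (b, a) ∈ signatures d (-p) := by
  refine ⟨swap_mem_badges_neg h.prop, fun y hy hle => ?_⟩
  have := h.le_of_le (y := (y.2, y.1)) (by simpa using swap_mem_badges_neg hy) ⟨hle.2, hle.1⟩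
  exact ⟨this.2, this.1⟩

end Symmetry

end BinaryForms

theorem theorem3p2 (s : ℕ) (hs : 1 ≤ s) (p : MvPolynomial (Fin 2) ℝ)
    (hp : p.IsHomogeneous (2 * s)) (a b c d : ℕ)
    (hab : (a, b) ∈ BinaryForms.signatures (2 * s) p)
    (hcd : (c, d) ∈ BinaryForms.signatures (2 * s) p)
    (hac : a > c) (hbd : b < d) :
    a + d ≥ s + 3 ∧ b + c ≥ s + 1 ∧ max (a + b) (c + d) ≥ s + 2 ∧
      1 ≤ a ∧ 1 ≤ b ∧ 1 ≤ c ∧ 1 ≤ d := by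
  have hs0 : s ≠ 0 := by omega
  -- The zero form has `(0, 0)` as only signature, whereas `a > c ≥ 0`.
  have hp0 : p ≠ 0 := by
    rintro rfl
    have h : a ≤ 0 := (hab.le_of_le BinaryForms.zero_mem_badges_zero
      ⟨Nat.zero_le a, Nat.zero_le b⟩).1
    omega
  have hbc := BinaryForms.lt_negative_add_positive hs0 hp0 hab.prop hcd.prop hac
  have hb : b ≠ 0 := by
    rintro rfl
    have := BinaryForms.le_of_mem_signatures hs0 hab
    omega
  have hc : c ≠ 0 := by
    rintro rfl
    have := BinaryForms.le_of_mem_signatures hs0 (BinaryForms.swap_mem_signatures_neg hcd)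
    omega
  -- `a ≥ c + 1` and `d ≥ b + 1` turn `b + c ≥ s + 1` into the bounds on `a + d` and on `a + b`.
  omega
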